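/- Let $R$ be a ring with identity (not necessarily commutative) and let $\mathcal S$ be any class of left $R$-modules. An exact sequence $0\to A\to B\to C\to 0$ of left $R$-modules is called $\mathcal S$-pure if $\operatorname{Hom}_R(U,B)\to\operatorname{Hom}_R(U,C)$ is surjective for every $U\in\mathcal S$. A right $R$-module $F$ is called $\mathcal S$-pure flat if for every $\mathcal S$-pure exact sequence $0\to A\to B\to C\to 0$ of left $R$-modules the induced homomorphism $F\otimes_R A\to F\otimes_R B$ is injective. Then every right $R$-module $M$ has an $\mathcal S$-pure flat cover; that is, there are an $\mathcal S$-pure flat right $R$-module $X$ and an $R$-homomorphism $\varphi:X\to M$ such that 1. for every $\mathcal S$-pure flat right $R$-module $X'$, the induced homomorphism $\operatorname{Hom}_R(X',X)\to\operatorname{Hom}_R(X',M)$ is surjective, and 2. every $R$-homomorphism $f:X\to X$ with $\varphi f=\varphi$ is an automorphism. -/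

import Mathlib

open scoped TensorProduct MulOpposite

universe u v w

namespace RelPure

section BalancedTensor

variable (R : Type u) [Ring R]

/-- The subgroup of `F ⊗[ℤ] A` generated by all `(x r) ⊗ a - x ⊗ (r a)`, where `F` is a right
`R`-module (a module over `Rᵐᵒᵖ`) and `A` is a left `R`-module. -/
def balancingSubgroup (F : Type v) (A : Type w) [AddCommGroup F] [Module Rᵐᵒᵖ F]
    [AddCommGroup A] [Module R A] : AddSubgroup (F ⊗[ℤ] A) :=
  AddSubgroup.closure
    {t | ∃ (x : F) (r : R) (a : A), t = (MulOpposite.op r • x) ⊗ₜ[ℤ] a - x ⊗ₜ[ℤ] (r • a)}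

/-- The tensor product over a not necessarily commutative ring `R` of a right `R`-module `F` and a
left `R`-module `A`, an abelian group. -/
abbrev BalancedTensor (F : Type v) (A : Type w) [AddCommGroup F] [Module Rᵐᵒᵖ F]
    [AddCommGroup A] [Module R A] : Type (max v w) :=
  (F ⊗[ℤ] A) ⧸ balancingSubgroup R F A

variable {R}

theorem balancingSubgroup_le_comap (F : Type v) {A B : Type w} [AddCommGroup F] [Module Rᵐᵒᵖ F]
    [AddCommGroup A] [Module R A] [AddCommGroup B] [Module R B] (f : A →ₗ[R] B) :
    balancingSubgroup R F A ≤ (balancingSubgroup R F B).comap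
      (TensorProduct.map (LinearMap.id : F →ₗ[ℤ] F) f.toAddMonoidHom.toIntLinearMap).toAddMonoidHom
    := by
  refine (AddSubgroup.closure_le _).2 ?_
  rintro _ ⟨x, r, a, rfl⟩
  refine AddSubgroup.subset_closure ⟨x, r, f a, ?_⟩
  simp [map_sub]

/-- The induced homomorphism `F ⊗_R A → F ⊗_R B`, `x ⊗ a ↦ x ⊗ f a`. -/
def balancedTensorMap (F : Type v) {A B : Type w} [AddCommGroup F] [Module Rᵐᵒᵖ F]
    [AddCommGroup A] [Module R A] [AddCommGroup B] [Module R B] (f : A →ₗ[R] B) :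
    BalancedTensor R F A →+ BalancedTensor R F B :=
  QuotientAddGroup.map _ _
    (TensorProduct.map (LinearMap.id : F →ₗ[ℤ] F) f.toAddMonoidHom.toIntLinearMap).toAddMonoidHom
    (balancingSubgroup_le_comap F f)

end BalancedTensor

section Purity

variable {R : Type u} [Ring R]

/-- `0 → A → B → C → 0` (with maps `f`, `g`) is an `S`-pure exact sequence of left `R`-modules. -/
structure IsPureExact (S : Set (ModuleCat.{v} R)) {A B C : ModuleCat.{v} R}
    (f : A →ₗ[R] B) (g : B →ₗ[R] C) : Prop where
  injective : Function.Injective f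
  exact : Function.Exact f g
  surjective : Function.Surjective g
  lift : ∀ U ∈ S, Function.Surjective (fun h : U →ₗ[R] B => g ∘ₗ h)

/-- The class of `S`-pure flat right `R`-modules. -/
def pureFlat (S : Set (ModuleCat.{v} R)) : Set (ModuleCat.{v} Rᵐᵒᵖ) :=
  {F | ∀ (A B C : ModuleCat.{v} R) (f : A →ₗ[R] B) (g : B →ₗ[R] C),
    IsPureExact S f g → Function.Injective (balancedTensorMap F f)}

end Purity

section Covers

variable {T : Type u} [Ring T]

/-- `φ : X → M` is an `𝒳`-precover of `M`. -/
def IsPrecover (𝒳 : Set (ModuleCat.{v} T)) {X M : ModuleCat.{v} T} (φ : X →ₗ[T] M) : Prop :=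
  X ∈ 𝒳 ∧ ∀ X' ∈ 𝒳, Function.Surjective (fun h : X' →ₗ[T] X => φ ∘ₗ h)

/-- `φ : X → M` is an `𝒳`-cover of `M`. -/
def IsCover (𝒳 : Set (ModuleCat.{v} T)) {X M : ModuleCat.{v} T} (φ : X →ₗ[T] M) : Prop :=
  IsPrecover 𝒳 φ ∧ ∀ f : X →ₗ[T] X, φ ∘ₗ f = φ → Function.Bijective f

end Covers

end RelPure

/-!
# Covers by relatively pure flat modules

Let `𝓕` be a class of modules such that `M ∈ 𝓕` as soon as every finite piece of `M` lifts to a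
member of `𝓕` (`LocallyIn`), and that contains `0` and is closed under binary products. These
conditions give closure under direct limits and pure quotients, and they suffice for every module
to have an `𝓕`-cover (`exists_isCover`). The class of `S`-pure flat modules is of this kind: an
element of `M ⊗ A` with image `0` in `M ⊗ B`, and a finite set of relations of `M` that causes this
vanishing, can be lifted together to a pure flat module, where the lifted element is `0`
(`mem_pureFlat_of_locallyIn`).

*Bounding the size.* Each linear map `F → M` with `F ∈ 𝓕` factors through a quotient of `F` in `𝓕`
whose size is at most a cardinal `κ` depending only on `M` and the ring (`exists_small_quotient`).
By Zorn's lemma it is enough to find, for large `F`, a nonzero pure submodule of `F` in the kernel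
(`exists_pureSubmodule_le_ker`, a theorem of Bican, El Bashir and Enochs). For this, take a proper
submodule `G` of `F` that realizes all types of short families over its short families, and a small
submodule `N` not contained in `G` that is pure modulo `G`. By saturation there is a linear map
`θ : N → G` over `M` that is the identity on `N ∩ G`. The range of `1 - θ` on `N` lies in the kernel
and meets `G` trivially, and it has the same image as `N` in `F ⧸ G`, so it is pure in `F`.

*From small quotients to covers.* The usual transfinite construction of a cover takes direct limits
of coherent systems of modules over `M`. Here all of these modules are subquotients `A ⧸ L`
(`Stage`) of one large module `B` over `M`, and the transition maps are induced by inclusions of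
submodules, so that coherence holds automatically and a form of Zorn's lemma (`exists_stable`)
replaces transfinite recursion. `B` contains so many independent copies of each small module
over `M` that each linear map from a small stage to a small member of `𝓕` is a transition map
(`Stage.exists_extension`). Stabilizing kernels gives a rigid stage, one from which all maps
over `M` to members of `𝓕` are
injective (`Stage.exists_rigid`). Chains of rigid stages with strictly growing images are short,
because their union is rigid and so embeds into a small module. Hence there is a rigid stage above
which no further growth is possible (`Stage.exists_maximal_rigid`), and it is a cover
(`Stage.isCover_of_maximal`).
-/

namespace RelPure

/-! ### Local lifting into a class of modules -/

/-- `M` lies locally in the class `𝓕` if every finite piece of `M` lifts along a linear map from a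
member of `𝓕`: for finitely many elements and finitely many linear relations holding in `M` there
are `Y ∈ 𝓕`, a linear map `g : Y → M` and a function `σ : M → Y` such that `σ` is a section of `g`
on the given elements and the elements `σ x` satisfy the given relations. A relation is encoded as
an element `e` of the free module `M →₀ T` that is sent to `0` in `M`.

Up to the language, this says that every linear map from a finitely presented module to `M`
factors through a member of `𝓕`. -/
def LocallyIn {T : Type u} [Ring T] (𝓕 : Set (ModuleCat.{w} T)) (M : Type w) [AddCommGroup M]
    [Module T M] : Prop :=
  ∀ (s : Set M) (E : Set (M →₀ T)), s.Finite → E.Finite →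
    (∀ e ∈ E, Finsupp.linearCombination T id e = 0) →
    ∃ Y ∈ 𝓕, ∃ (g : Y →ₗ[T] M) (σ : M → Y),
      (∀ x ∈ s, g (σ x) = x) ∧ ∀ e ∈ E, Finsupp.linearCombination T σ e = 0

/-! ### The balanced tensor product -/

section Tensor

variable {R : Type u} [Ring R]

/-- The class of `x ⊗ a` in `F ⊗_R A`. -/
def tens {F : Type v} {A : Type w} [AddCommGroup F] [Module Rᵐᵒᵖ F] [AddCommGroup A] [Module R A]
    (x : F) (a : A) : BalancedTensor R F A :=
  QuotientAddGroup.mk (x ⊗ₜ[ℤ] a)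

section

variable {F : Type v} {A : Type w} [AddCommGroup F] [Module Rᵐᵒᵖ F] [AddCommGroup A] [Module R A]

theorem tens_add_left (x y : F) (a : A) : tens (R := R) (x + y) a = tens x a + tens y a := by
  simp [tens, TensorProduct.add_tmul]

theorem tens_add_right (x : F) (a b : A) : tens (R := R) x (a + b) = tens x a + tens x b := by
  simp [tens, TensorProduct.tmul_add]

theorem tens_smul (r : R) (x : F) (a : A) :
    tens (R := R) (MulOpposite.op r • x) a = tens x (r • a) :=
  QuotientAddGroup.eq_iff_sub_mem.2 (AddSubgroup.subset_closure ⟨x, r, a, rfl⟩)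

theorem tens_zero_left (a : A) : tens (R := R) (0 : F) a = 0 := by
  simp [tens]

/-- Two additive maps on `F ⊗_R A` agree if they agree on the elements `x ⊗ a`. -/
theorem balancedTensor_hom_ext {G : Type*} [AddCommGroup G] {f g : BalancedTensor R F A →+ G}
    (h : ∀ x a, f (tens x a) = g (tens x a)) : f = g := by
  refine QuotientAddGroup.addMonoidHom_ext _ ?_
  refine AddMonoidHom.ext fun t => ?_
  induction t using TensorProduct.induction_on with
  | zero => simp
  | tmul x a => exact h x a
  | add x y hx hy => simp only [map_add, hx, hy]

/-- The universal property of `F ⊗_R A`: a balanced biadditive map induces an additive map. -/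
def balancedLift {G : Type*} [AddCommGroup G] (h : F →+ A →+ G)
    (hb : ∀ (r : R) x a, h (MulOpposite.op r • x) a = h x (r • a)) :
    BalancedTensor R F A →+ G :=
  QuotientAddGroup.lift _
    (TensorProduct.liftAddHom h (fun n x a => by simp)) (by
      refine (AddSubgroup.closure_le _).2 ?_
      rintro _ ⟨x, r, a, rfl⟩
      simp [hb])

end

theorem balancedTensorMap_tens (F : Type v) {A B : Type w} [AddCommGroup F] [Module Rᵐᵒᵖ F]
    [AddCommGroup A] [Module R A] [AddCommGroup B] [Module R B] (f : A →ₗ[R] B) (x : F) (a : A) :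
    balancedTensorMap F f (tens x a) = tens x (f a) :=
  rfl

section

variable {F F' : Type v} {A B : Type w} [AddCommGroup F] [Module Rᵐᵒᵖ F]
  [AddCommGroup F'] [Module Rᵐᵒᵖ F'] [AddCommGroup A] [Module R A] [AddCommGroup B] [Module R B]

/-- The induced homomorphism `F ⊗_R A → F' ⊗_R A`, `x ⊗ a ↦ g x ⊗ a`. -/
def tensorMapLeft (g : F →ₗ[Rᵐᵒᵖ] F') (A : Type w) [AddCommGroup A] [Module R A] :
    BalancedTensor R F A →+ BalancedTensor R F' A :=
  balancedLift
    (AddMonoidHom.mk' (fun x => AddMonoidHom.mk' (fun a => tens (g x) a)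
      (fun a b => tens_add_right _ a b))
      (fun x y => AddMonoidHom.ext fun a => by simp [tens_add_left]))
    (fun r x a => by simp [tens_smul])

theorem tensorMapLeft_tens (g : F →ₗ[Rᵐᵒᵖ] F') (x : F) (a : A) :
    tensorMapLeft g A (tens x a) = tens (g x) a :=
  rfl

theorem tensorMapLeft_balancedTensorMap (g : F →ₗ[Rᵐᵒᵖ] F') (f : A →ₗ[R] B)
    (t : BalancedTensor R F A) :
    tensorMapLeft g B (balancedTensorMap F f t) = balancedTensorMap F' f (tensorMapLeft g A t) := by
  have : (tensorMapLeft g B).comp (balancedTensorMap F f)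
      = (balancedTensorMap F' f).comp (tensorMapLeft g A) :=
    balancedTensor_hom_ext fun x a => rfl
  exact DFunLike.congr_fun this t

end

/-! ### Finiteness of vanishing in a tensor product -/

section Formal

variable (F : Type v) (A : Type w) [AddCommGroup F] [Module Rᵐᵒᵖ F] [AddCommGroup A] [Module R A]

/-- The tautological map from formal sums of pairs `(x, a)` to `F ⊗_R A`. -/
def formalTensor : FreeAbelianGroup (F × A) →+ BalancedTensor R F A :=
  FreeAbelianGroup.lift fun p => tens p.1 p.2

theorem formalTensor_of (x : F) (a : A) :
    formalTensor (R := R) F A (FreeAbelianGroup.of (x, a)) = tens x a := by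
  simp [formalTensor]

theorem formalTensor_surjective : Function.Surjective (formalTensor (R := R) F A) := by
  intro t
  obtain ⟨t, rfl⟩ := QuotientAddGroup.mk_surjective t
  induction t using TensorProduct.induction_on with
  | zero => exact ⟨0, by simp⟩
  | tmul x a => exact ⟨FreeAbelianGroup.of (x, a), formalTensor_of F A x a⟩
  | add x y hx hy =>
    obtain ⟨p, hp⟩ := hx
    obtain ⟨q, hq⟩ := hy
    exact ⟨p + q, by rw [map_add, hp, hq]; rfl⟩

end Formal

variable (M : Type v) (B : Type w) [AddCommGroup M] [Module Rᵐᵒᵖ M] [AddCommGroup B] [Module R B]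

/-- The subgroup of those formal sums of pairs in `M × B` whose vanishing in `M ⊗_R B` is caused by
finitely many linear relations of `M`: every function `σ` from `M` to a module that respects these
relations sends the formal sum to one that vanishes in the tensor product. -/
def finitelyVanishing : AddSubgroup (FreeAbelianGroup (M × B)) where
  carrier := {w | ∃ E : Set (M →₀ Rᵐᵒᵖ), E.Finite ∧
    (∀ e ∈ E, Finsupp.linearCombination Rᵐᵒᵖ id e = 0) ∧
    ∀ (Y : ModuleCat.{v} Rᵐᵒᵖ) (σ : M → Y),
      (∀ e ∈ E, Finsupp.linearCombination Rᵐᵒᵖ σ e = 0) →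
      formalTensor (R := R) Y B (FreeAbelianGroup.map (Prod.map σ id) w) = 0}
  zero_mem' := ⟨∅, Set.finite_empty, by simp, by simp⟩
  add_mem' := by
    rintro a b ⟨E, hE, hE', h⟩ ⟨E₂, hE₂, hE₂', h₂⟩
    refine ⟨E ∪ E₂, hE.union hE₂, ?_, fun Y σ hσ => ?_⟩
    · rintro e (he | he)
      exacts [hE' e he, hE₂' e he]
    · rw [map_add, map_add, h Y σ fun e he => hσ e (Or.inl he),
        h₂ Y σ fun e he => hσ e (Or.inr he), add_zero]
  neg_mem' := by
    rintro a ⟨E, hE, hE', h⟩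
    exact ⟨E, hE, hE', fun Y σ hσ => by rw [map_neg, map_neg, h Y σ hσ, neg_zero]⟩

variable {M B}

/-- A formal sum that vanishes in `M ⊗_R B` does so because of finitely many relations: by the
universal property of `M ⊗_R B`, the tensor product maps to the quotient of the formal sums by
`finitelyVanishing M B`. -/
theorem mem_finitelyVanishing {w : FreeAbelianGroup (M × B)}
    (hw : formalTensor (R := R) M B w = 0) :
    w ∈ finitelyVanishing (R := R) M B := by
  let K := finitelyVanishing (R := R) M B
  let π : FreeAbelianGroup (M × B) →+ FreeAbelianGroup (M × B) ⧸ K := QuotientAddGroup.mk' K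
  have eq_of {a b : FreeAbelianGroup (M × B)} (h : a - b ∈ K) : π a = π b :=
    QuotientAddGroup.eq_iff_sub_mem.2 h
  have hright (x : M) (a b : B) : π (.of (x, a + b)) = π (.of (x, a)) + π (.of (x, b)) := by
    rw [← map_add]
    refine eq_of ⟨∅, Set.finite_empty, by simp, fun Y σ _ => ?_⟩
    simp [formalTensor_of, tens_add_right]
  have hleft (x y : M) (a : B) : π (.of (x + y, a)) = π (.of (x, a)) + π (.of (y, a)) := by
    rw [← map_add]
    refine eq_of ⟨{Finsupp.single (x + y) 1 - (Finsupp.single x 1 + Finsupp.single y 1)},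
      Set.finite_singleton _, by simp, fun Y σ hσ => ?_⟩
    have := hσ _ rfl
    rw [map_sub, sub_eq_zero] at this
    simp only [map_add, Finsupp.linearCombination_single, one_smul] at this
    simp [formalTensor_of, this, tens_add_left]
  have hbal (r : R) (x : M) (a : B) :
      π (.of (MulOpposite.op r • x, a)) = π (.of (x, r • a)) := by
    refine eq_of ⟨{Finsupp.single (MulOpposite.op r • x) 1 - Finsupp.single x (MulOpposite.op r)},
      Set.finite_singleton _, by simp, fun Y σ hσ => ?_⟩
    have := hσ _ rfl
    rw [map_sub, sub_eq_zero] at this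
    simp only [Finsupp.linearCombination_single, one_smul] at this
    simp [formalTensor_of, this, tens_smul]
  let Λ : BalancedTensor R M B →+ FreeAbelianGroup (M × B) ⧸ K :=
    balancedLift (AddMonoidHom.mk' (fun x => AddMonoidHom.mk' (fun a => π (.of (x, a)))
      (hright x)) (fun x y => AddMonoidHom.ext fun a => hleft x y a)) hbal
  have hΛ : Λ.comp (formalTensor M B) = π := by
    refine FreeAbelianGroup.lift_ext _ _ fun p => ?_
    rw [AddMonoidHom.comp_apply, formalTensor_of]
    rfl
  have : π w = 0 := by rw [← hΛ, AddMonoidHom.comp_apply, hw, map_zero]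
  exact (QuotientAddGroup.eq_zero_iff w).1 this

/-- A section on the finitely many elements of `M` that occur in a formal sum recovers its value in
the tensor product. -/
theorem exists_finite_section (w : FreeAbelianGroup (M × B)) :
    ∃ s : Set M, s.Finite ∧ ∀ (Y : ModuleCat.{v} Rᵐᵒᵖ) (g : Y →ₗ[Rᵐᵒᵖ] M) (σ : M → Y),
      (∀ x ∈ s, g (σ x) = x) →
      tensorMapLeft g B (formalTensor Y B (FreeAbelianGroup.map (Prod.map σ id) w))
        = formalTensor (R := R) M B w := by
  induction w using FreeAbelianGroup.induction_on with
  | zero => exact ⟨∅, Set.finite_empty, by simp⟩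
  | of p =>
    refine ⟨{p.1}, Set.finite_singleton _, fun Y g σ h => ?_⟩
    obtain ⟨x, a⟩ := p
    have := h x rfl
    simp [formalTensor_of, tensorMapLeft_tens, this]
  | neg p ih =>
    obtain ⟨s, hs, h⟩ := ih
    exact ⟨s, hs, fun Y g σ hσ => by rw [map_neg, map_neg, map_neg, map_neg, h Y g σ hσ]⟩
  | add p q ihp ihq =>
    obtain ⟨s, hs, h⟩ := ihp
    obtain ⟨s', hs', h'⟩ := ihq
    refine ⟨s ∪ s', hs.union hs', fun Y g σ hσ => ?_⟩
    rw [map_add, map_add, map_add, map_add, h Y g σ fun x hx => hσ x (Or.inl hx),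
      h' Y g σ fun x hx => hσ x (Or.inr hx)]

end Tensor

/-! ### Closure properties of the class of pure flat modules -/

section PureFlat

variable {R : Type u} [Ring R] (S : Set (ModuleCat.{v} R))

/-- The class of `S`-pure flat modules is closed under local membership: an element `t` of `M ⊗ A`
with image `0` in `M ⊗ B` lifts, together with the finitely many relations that make its image
vanish, to an `S`-pure flat module `Y`. There the lift of `t` is `0`, hence so is `t`. -/
theorem mem_pureFlat_of_locallyIn {M : ModuleCat.{v} Rᵐᵒᵖ} (hM : LocallyIn (pureFlat S) M) :
    M ∈ pureFlat S := by
  intro A B C f g hfg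
  refine (injective_iff_map_eq_zero _).2 fun t ht => ?_
  obtain ⟨w, rfl⟩ := formalTensor_surjective M A t
  have naturality (Y : ModuleCat.{v} Rᵐᵒᵖ) (w : FreeAbelianGroup (Y × A)) :
      balancedTensorMap Y f (formalTensor Y A w)
        = formalTensor Y B (FreeAbelianGroup.map (Prod.map id f) w) := by
    have : (balancedTensorMap Y f).comp (formalTensor Y A)
        = (formalTensor Y B).comp (FreeAbelianGroup.map (Prod.map id f)) :=
      FreeAbelianGroup.lift_ext _ _ fun p => by
        simp only [AddMonoidHom.comp_apply, FreeAbelianGroup.map_of_apply]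
        rw [formalTensor_of, balancedTensorMap_tens, Prod.map, formalTensor_of]
        rfl
    exact DFunLike.congr_fun this w
  rw [naturality] at ht
  obtain ⟨E, hE, hE', hvan⟩ := mem_finitelyVanishing ht
  obtain ⟨s, hs, hsec⟩ := exists_finite_section (R := R) w
  obtain ⟨Y, hY, h, σ, hσs, hσE⟩ := hM s E hs hE hE'
  rw [← hsec Y h σ hσs]
  suffices formalTensor Y A (FreeAbelianGroup.map (Prod.map σ id) w) = 0 by
    rw [this, map_zero]
  apply hY A B C f g hfg
  rw [naturality, map_zero, ← hvan Y σ hσE]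
  congr 1
  have : (FreeAbelianGroup.map (Prod.map id f)).comp (FreeAbelianGroup.map (Prod.map σ id))
      = (FreeAbelianGroup.map (Prod.map σ id)).comp
        (FreeAbelianGroup.map (Prod.map (id : M → M) f)) :=
    FreeAbelianGroup.lift_ext _ _ fun p => by simp [Prod.map]
  exact DFunLike.congr_fun this w

theorem punit_mem_pureFlat : ModuleCat.of Rᵐᵒᵖ PUnit.{v + 1} ∈ pureFlat S := by
  intro A B C f g _
  refine (injective_iff_map_eq_zero _).2 fun t _ => ?_
  have : AddMonoidHom.id (BalancedTensor R PUnit.{v + 1} A) = 0 :=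
    balancedTensor_hom_ext fun x a => tens_zero_left a
  exact DFunLike.congr_fun this t

theorem prod_mem_pureFlat {X Y : Type v} [AddCommGroup X] [Module Rᵐᵒᵖ X] [AddCommGroup Y]
    [Module Rᵐᵒᵖ Y] (hX : ModuleCat.of Rᵐᵒᵖ X ∈ pureFlat S)
    (hY : ModuleCat.of Rᵐᵒᵖ Y ∈ pureFlat S) :
    ModuleCat.of Rᵐᵒᵖ (X × Y) ∈ pureFlat S := by
  intro A B C f g hfg
  refine (injective_iff_map_eq_zero _).2 fun (t : BalancedTensor R (X × Y) A) ht => ?_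
  have h₁ : tensorMapLeft (LinearMap.fst Rᵐᵒᵖ X Y) A t = 0 := by
    apply hX A B C f g hfg
    change balancedTensorMap X f _ = _
    rw [← tensorMapLeft_balancedTensorMap]
    erw [ht]
    simp
  have h₂ : tensorMapLeft (LinearMap.snd Rᵐᵒᵖ X Y) A t = 0 := by
    apply hY A B C f g hfg
    change balancedTensorMap Y f _ = _
    rw [← tensorMapLeft_balancedTensorMap]
    erw [ht]
    simp
  have : AddMonoidHom.id (BalancedTensor R (X × Y) A)
      = (tensorMapLeft (LinearMap.inl Rᵐᵒᵖ X Y) A).comp (tensorMapLeft (LinearMap.fst Rᵐᵒᵖ X Y) A)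
      + (tensorMapLeft (LinearMap.inr Rᵐᵒᵖ X Y) A).comp
        (tensorMapLeft (LinearMap.snd Rᵐᵒᵖ X Y) A) :=
    balancedTensor_hom_ext fun x a => by
      simp [tensorMapLeft_tens, ← tens_add_left]
  have := DFunLike.congr_fun this t
  simpa [h₁, h₂] using this

end PureFlat

/-! ### Submodules closed under operations of infinite arity -/

section Closure

open Cardinal

/-- For operations of a fixed arity `D` there is a closed set containing a given element whose size
is bounded in terms of the number of operations: the set of values of all well-founded terms. -/
theorem exists_closed_set {F D α : Type w} {κ : Cardinal.{w}} (op : α → (D → F) → F) (x : F)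
    (h0 : ℵ₀ ≤ κ) (hα : #α ≤ κ) (hD : κ ^ #D ≤ κ) :
    ∃ X : Set F, #X ≤ κ ∧ x ∈ X ∧ ∀ a g, (∀ d, g d ∈ X) → op a g ∈ X := by
  let β : Option α → Type w := fun a => a.elim PEmpty fun _ => D
  let opx : (Σ a, (β a → F)) → F := fun p => match p with
    | ⟨none, _⟩ => x
    | ⟨some a, g⟩ => op a g
  let ev : WType β → F := WType.elim F opx
  refine ⟨Set.range ev, mk_range_le.trans (WType.cardinalMk_le_of_le ?_),
    ⟨WType.mk none PEmpty.elim, rfl⟩, fun a g hg => ?_⟩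
  · have hβ (a : Option α) : κ ^ #(β a) ≤ κ := by
      cases a with
      | none => simpa [β] using one_le_aleph0.trans h0
      | some a => exact hD
    refine (sum_le_sum _ (fun _ => κ) hβ).trans ?_
    rw [sum_const', mk_option]
    exact (mul_le_mul' (add_le_of_le h0 hα (one_le_aleph0.trans h0)) le_rfl).trans
      (mul_eq_self h0).le
  · choose t ht using hg
    refine ⟨WType.mk (some a) t, ?_⟩
    change op a (fun d => ev (t d)) = _
    exact congrArg _ (funext ht)

variable {T : Type u} [Ring T]

theorem mk_finsupp_le {D : Type max u v} {κ : Cardinal.{max u v}} (h0 : ℵ₀ ≤ κ)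
    (hD : #D ≤ κ) (hT : lift.{max u v} #T ≤ κ) : #(D →₀ T) ≤ κ := by
  classical
  have h : #(D →₀ T) ≤ #(Finset (D × T)) :=
    mk_le_of_injective (f := Finsupp.graph) (Finsupp.graph_injective _ _)
  refine h.trans ?_
  have h2 : #(D × T) ≤ κ := by
    rw [mk_prod]
    refine (mul_le_mul' ?_ ?_).trans (mul_eq_self h0).le
    · rwa [lift_id'.{u, max u v}]
    · simpa using hT
  cases finite_or_infinite (D × T)
  · exact (lt_aleph0_of_finite _).le.trans h0
  · rwa [mk_finset_of_infinite]

/-- The version of `exists_closed_set` for submodules: linear combinations of families indexed by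
`D` are added to the operations. -/
theorem exists_closed_submodule {F D α : Type max u v} [AddCommGroup F] [Module T F] [Infinite D]
    {κ : Cardinal.{max u v}} (op : α → (D → F) → F) (x : F) (h0 : ℵ₀ ≤ κ) (hα : #α ≤ κ)
    (hD : κ ^ #D ≤ κ) (hDκ : #D ≤ κ) (hT : lift.{max u v} #T ≤ κ) :
    ∃ X : Submodule T F, #X ≤ κ ∧ x ∈ X ∧ ∀ a g, (∀ d, g d ∈ X) → op a g ∈ X := by
  classical
  have hα' : #(α ⊕ (D →₀ T)) ≤ κ := by
    rw [mk_sum, lift_id, lift_id]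
    exact add_le_of_le h0 hα (mk_finsupp_le.{u, v} h0 hDκ hT)
  obtain ⟨X, hX, hx, hcl⟩ := exists_closed_set (κ := κ)
    (Sum.elim op fun c g => Finsupp.linearCombination T g c) x h0 hα' hD
  have hlc (c : D →₀ T) (g : D → F) (hg : ∀ d, g d ∈ X) :
      Finsupp.linearCombination T g c ∈ X := hcl (.inr c) g hg
  obtain ⟨i, j, hij⟩ := exists_pair_ne D
  refine ⟨{ carrier := X, add_mem' := ?_, zero_mem' := ?_, smul_mem' := ?_ }, hX, hx,
    fun a g hg => hcl (.inl a) g hg⟩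
  · intro a b ha hb
    have := hlc (Finsupp.single i 1 + Finsupp.single j 1) (fun d => if d = i then a else b)
      (fun d => by split_ifs <;> assumption)
    simpa [hij.symm] using this
  · simpa using hlc 0 (fun _ => x) fun _ => hx
  · intro t a ha
    simpa using hlc (Finsupp.single i t) (fun _ => a) fun _ => ha

end Closure

/-! ### Pure submodules in the kernel of a map from a large module -/

section Pure

open Cardinal

/-- A submodule `P` of `F` is pure if every finite system of linear relations that holds in `F ⧸ P`
lifts to `F`, by a section of the quotient map. -/
def IsPureSubmodule {T : Type u} [Ring T] {F : Type w} [AddCommGroup F] [Module T F]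
    (P : Submodule T F) : Prop :=
  ∀ E : Set ((F ⧸ P) →₀ T), E.Finite → (∀ e ∈ E, Finsupp.linearCombination T id e = 0) →
    ∃ σ : F ⧸ P → F, (∀ x, P.mkQ (σ x) = x) ∧ ∀ e ∈ E, Finsupp.linearCombination T σ e = 0

theorem IsPureSubmodule.locallyIn {T : Type u} [Ring T] {𝓕 : Set (ModuleCat.{w} T)} {F : Type w}
    [AddCommGroup F] [Module T F] {P : Submodule T F} (hP : IsPureSubmodule P)
    (hF : ModuleCat.of T F ∈ 𝓕) : LocallyIn 𝓕 (F ⧸ P) := by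
  intro s E _ hE hE'
  obtain ⟨σ, h, h'⟩ := hP E hE hE'
  exact ⟨ModuleCat.of T F, hF, P.mkQ, σ, fun x _ => h x, h'⟩

/-- `N` solves finite systems of linear equations with constants in `N` modulo `G` whenever they
are solvable modulo `G` in the whole module, so that `N` has a pure image in the quotient by `G`.
The unknowns are indexed by `Q`, and an equation by its left-hand side `e : Q →₀ T`; its right-hand
side is `k e`. -/
def SolvesModulo {T : Type u} [Ring T] {F : Type w} [AddCommGroup F] [Module T F]
    (N G : Submodule T F) : Prop :=
  ∀ (Q : Type w) (E : Set (Q →₀ T)), E.Finite → ∀ k : (Q →₀ T) → F, (∀ e ∈ E, k e ∈ N) →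
    (∃ y : Q → F, ∀ e ∈ E, Finsupp.linearCombination T y e - k e ∈ G) →
    ∃ y : Q → F, (∀ q, y q ∈ N) ∧ ∀ e ∈ E, Finsupp.linearCombination T y e - k e ∈ G

/-- If `θ : N → G` is the identity on `N ∩ G` and `N` is pure modulo `G`, then the range of
`1 - θ` on `N` is a pure submodule. -/
theorem isPureSubmodule_range {T : Type u} [Ring T] {F : Type w} [AddCommGroup F] [Module T F]
    {N G : Submodule T F} (hN : SolvesModulo N G) (θ : N →ₗ[T] F) (hθ : ∀ x, θ x ∈ G)
    (hid : ∀ x : N, (x : F) ∈ G → θ x = x) :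
    IsPureSubmodule (LinearMap.range (N.subtype - θ)) := by
  set P := LinearMap.range (N.subtype - θ)
  intro E hE hE'
  let ρ : F ⧸ P → F := Function.surjInv P.mkQ_surjective
  have hρ (x) : P.mkQ (ρ x) = x := Function.surjInv_eq _ x
  -- a section `ρ` satisfies the relations up to errors `(1 - θ) n`; a solution in `N` modulo `G` of
  -- the system with right-hand sides `n` corrects it, since `1 - θ` vanishes on `N ∩ G`
  have hmem : ∀ e : (F ⧸ P) →₀ T, ∃ n : N, e ∈ E → Finsupp.linearCombination T ρ e = n - θ n := by
    intro e
    by_cases he : e ∈ E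
    · have : P.mkQ (Finsupp.linearCombination T ρ e) = 0 := by
        rw [← hE' e he, Finsupp.apply_linearCombination]
        congr 2
        exact funext hρ
      obtain ⟨n, hn⟩ := (Submodule.Quotient.mk_eq_zero P).1 this
      exact ⟨n, fun _ => hn.symm⟩
    · exact ⟨0, fun h => absurd h he⟩
  choose n hn using hmem
  obtain ⟨y, hy, hyE⟩ := hN (F ⧸ P) E hE (fun e => n e) (fun e _ => (n e).2)
    ⟨ρ, fun e he => by
      rw [hn e he, sub_sub_cancel_left]
      exact G.neg_mem (hθ _)⟩
  let z : F ⧸ P → N := fun q => ⟨y q, hy q⟩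
  refine ⟨fun q => ρ q - (N.subtype - θ) (z q), fun q => ?_, fun e he => ?_⟩
  · rw [map_sub, hρ, sub_eq_self]
    exact (Submodule.Quotient.mk_eq_zero P).2 ⟨z q, rfl⟩
  · have h₁ : Finsupp.linearCombination T (fun q => ρ q - (N.subtype - θ) (z q)) e
        = Finsupp.linearCombination T ρ e
          - (N.subtype - θ) (Finsupp.linearCombination T z e) := by
      rw [Finsupp.apply_linearCombination]
      simp only [Finsupp.linearCombination_apply, smul_sub, Finsupp.sum_sub, Function.comp]
    have h₂ : ((Finsupp.linearCombination T z e : N) : F) = Finsupp.linearCombination T y e := by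
      rw [← N.subtype_apply, Finsupp.apply_linearCombination]
      rfl
    have h₃ := hid (Finsupp.linearCombination T z e - n e) (by
      rw [Submodule.coe_sub, h₂]
      exact hyE e he)
    rw [map_sub, Submodule.coe_sub] at h₃
    rw [h₁, hn e he, LinearMap.sub_apply, Submodule.subtype_apply, sub_eq_zero, ← sub_eq_zero,
      ← sub_eq_zero.2 h₃]
    abel

variable {T : Type u} [Ring T]

/-- Every element lies in a small submodule that is pure modulo `G`. -/
theorem exists_small_solvesModulo {F : Type max u v} [AddCommGroup F] [Module T F]
    (G : Submodule T F) (x : F) {μ : Cardinal.{max u v}} (h0 : ℵ₀ ≤ μ)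
    (hT : lift.{max u v} #T ≤ μ) :
    ∃ N : Submodule T F, x ∈ N ∧ #N ≤ 2 ^ μ ∧ SolvesModulo N G := by
  classical
  obtain ⟨D, rfl⟩ : ∃ D : Type max u v, #D = μ := ⟨_, mk_out μ⟩
  have hinf : Infinite D := infinite_iff.2 h0
  have h2 : #D ≤ 2 ^ #D := (cantor _).le
  let op : (D → (D →₀ T)) × D → (D → F) → F := fun a k =>
    if h : ∃ y : D → F, ∀ d, Finsupp.linearCombination T y (a.1 d) - k d ∈ G then h.choose a.2
    else 0
  have hα : #((D → (D →₀ T)) × D) ≤ 2 ^ #D := by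
    rw [mk_prod, lift_id, lift_id, mk_pi, prod_const']
    refine (mul_le_mul' ?_ h2).trans (mul_eq_self (h0.trans h2)).le
    exact (power_le_power_right (mk_finsupp_le.{u, v} h0 le_rfl hT)).trans (power_self_eq h0).le
  obtain ⟨N, hN, hx, hcl⟩ := exists_closed_submodule.{u, v} (κ := 2 ^ #D) op x (h0.trans h2) hα
    (by rw [← power_mul, mul_eq_self h0]) h2 (hT.trans h2)
  refine ⟨N, hx, hN, fun Q E hE k hk hy => ?_⟩
  obtain ⟨y₀, hy₀⟩ := hy
  rcases E.eq_empty_or_nonempty with rfl | hne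
  · exact ⟨0, fun _ => N.zero_mem, by simp⟩
  -- rename the finitely many unknowns and enumerate the finitely many equations by `D`
  have : Finite E := hE
  have : Nonempty E := hne.to_subtype
  let Q₀ : Set Q := ⋃ e ∈ E, (e.support : Set Q)
  have hQ₀ : Q₀.Finite := hE.biUnion fun e _ => e.support.finite_toSet
  have : Finite Q₀ := hQ₀
  obtain ⟨ι⟩ : Nonempty (Q₀ ↪ D) :=
    (le_def _ _).1 ((lt_aleph0_of_finite Q₀).le.trans h0)
  obtain ⟨c, hc⟩ : ∃ c : D → E, Function.Surjective c := by
    obtain ⟨j⟩ := (le_def _ _).1 ((lt_aleph0_of_finite E).le.trans h0)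
    exact ⟨_, Function.invFun_surjective j.injective⟩
  let r : Q → D := fun q => if h : q ∈ Q₀ then ι ⟨q, h⟩ else Classical.arbitrary D
  let a : D → (D →₀ T) := fun d => Finsupp.mapDomain r (c d).1
  have hsolv : ∃ y : D → F, ∀ d, Finsupp.linearCombination T y (a d) - k (c d) ∈ G := by
    refine ⟨Function.extend (fun q : Q₀ => ι q) (fun q => y₀ q) 0, fun d => ?_⟩
    rw [Finsupp.linearCombination_mapDomain]
    convert hy₀ _ (c d).2 using 2
    refine Finsupp.sum_congr fun q hq => ?_
    have hq : q ∈ Q₀ := Set.mem_biUnion (c d).2 hq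
    simp only [LinearMap.smulRight_apply, LinearMap.id_apply, Function.comp, r, dif_pos hq]
    rw [ι.injective.extend_apply]
  refine ⟨fun q => hsolv.choose (r q), fun q => ?_, fun e he => ?_⟩
  · have := hcl (a, r q) (fun d => k (c d)) fun d => hk _ (c d).2
    simpa only [op, dif_pos hsolv] using this
  · obtain ⟨d, hd⟩ := hc ⟨e, he⟩
    have := hsolv.choose_spec d
    rw [Finsupp.linearCombination_mapDomain, hd] at this
    exact this

/-- In a module `F` of size more than `2 ^ 2 ^ μ`, where the infinite cardinal `μ` bounds the sizes
of the ring and of `M`, the kernel of any linear map to `M` contains a nonzero pure submodule of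
`F`. -/
theorem exists_pureSubmodule_le_ker {F M : Type max u v} [AddCommGroup F] [Module T F]
    [AddCommGroup M] [Module T M] (φ : F →ₗ[T] M) {μ : Cardinal.{max u v}} (h0 : ℵ₀ ≤ μ)
    (hT : lift.{max u v} #T ≤ μ) (hM : #M ≤ μ) (hF : 2 ^ (2 ^ μ : Cardinal.{max u v}) < #F) :
    ∃ P : Submodule T F, P ≠ ⊥ ∧ P ≤ LinearMap.ker φ ∧ IsPureSubmodule P := by
  classical
  obtain ⟨I, hI⟩ : ∃ I : Type max u v, #I = 2 ^ μ := ⟨_, mk_out _⟩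
  have hμI : μ ≤ #I := hI ▸ (cantor μ).le
  have h0I : ℵ₀ ≤ #I := h0.trans hμI
  have hinf : Infinite I := infinite_iff.2 h0I
  have h2 : #I ≤ 2 ^ #I := (cantor _).le
  rw [← hI] at hF
  -- the type of a family `n`: the linear relations between its members, and their images in `M`
  let tp : (I → F) → Set (I →₀ T) × (I → M) := fun n =>
    ({c | Finsupp.linearCombination T n c = 0}, fun i => φ (n i))
  let op : ((Set (I →₀ T) × (I → M)) × Set I) × I → (I → F) → F := fun a g =>
    if h : ∃ n : I → F, tp n = a.1.1 ∧ ∀ i ∈ a.1.2, n i = g i then h.choose a.2 else 0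
  have hα : #(((Set (I →₀ T) × (I → M)) × Set I) × I) ≤ 2 ^ #I := by
    have hmul {a b : Cardinal.{max u v}} (ha : a ≤ 2 ^ #I) (hb : b ≤ 2 ^ #I) : a * b ≤ 2 ^ #I :=
      (mul_le_mul' ha hb).trans (mul_eq_self (h0I.trans h2)).le
    simp only [mk_prod, lift_id, mk_set, mk_pi, prod_const']
    refine hmul (hmul (hmul ?_ ?_) le_rfl) h2
    · exact power_le_power_left two_ne_zero (mk_finsupp_le.{u, v} h0I le_rfl (hT.trans hμI))
    · exact (power_le_power_right (hM.trans hμI)).trans (power_self_eq h0I).le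
  obtain ⟨G, hG, -, hcl⟩ := exists_closed_submodule.{u, v} (κ := 2 ^ #I) op 0 (h0I.trans h2) hα
    (by rw [← power_mul, mul_eq_self h0I]) h2 (hT.trans (hμI.trans h2))
  obtain ⟨x, hx⟩ : ∃ x, x ∉ G := by
    by_contra! h
    refine (hG.trans_lt hF).not_ge ?_
    exact mk_le_of_injective (f := fun x : F => (⟨x, h x⟩ : G)) fun a b hab => by simpa using hab
  obtain ⟨N, hxN, hN, hsolv⟩ := exists_small_solvesModulo.{u, v} G x h0 hT
  obtain ⟨e, he⟩ : ∃ e : I → N, Function.Surjective e := by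
    rw [← hI] at hN
    obtain ⟨j⟩ := (le_def _ _).1 hN
    exact ⟨_, Function.invFun_surjective j.injective⟩
  let n : I → F := fun i => e i
  let g : I → F := fun i => if n i ∈ G then n i else 0
  have hex : ∃ m : I → F, tp m = tp n ∧ ∀ i ∈ {i | n i ∈ G}, m i = g i :=
    ⟨n, rfl, fun i (hi : n i ∈ G) => by simp only [g, if_pos hi]⟩
  obtain ⟨m, hmtp, hmg, hmG⟩ : ∃ m : I → F, tp m = tp n ∧ (∀ i, n i ∈ G → m i = n i) ∧
      ∀ i, m i ∈ G := by
    refine ⟨hex.choose, hex.choose_spec.1, fun i hi => ?_, fun i => ?_⟩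
    · rw [hex.choose_spec.2 i hi]
      simp only [g, if_pos hi]
    · have := hcl ((tp n, {i | n i ∈ G}), i) g fun d => by
        simp only [g]
        split_ifs with h
        exacts [h, G.zero_mem]
      simpa only [op, dif_pos hex] using this
  have hrel (c : I →₀ T) : Finsupp.linearCombination T m c = 0 ↔
      Finsupp.linearCombination T n c = 0 := Set.ext_iff.1 (congrArg Prod.fst hmtp) c
  have hφ (i : I) : φ (m i) = φ (n i) := congrFun (congrArg Prod.snd hmtp) i
  have hcoe (c : I →₀ T) : ((Finsupp.linearCombination T e c : N) : F)
      = Finsupp.linearCombination T n c := by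
    rw [← N.subtype_apply, Finsupp.apply_linearCombination]
    rfl
  -- since `m` satisfies the relations of `n`, there is a linear map sending `n i` to `m i`
  obtain ⟨θ, hθ⟩ : ∃ θ : N →ₗ[T] F, ∀ i, θ (e i) = m i := by
    have hsur : Function.Surjective (Finsupp.linearCombination T e) := fun y => by
      obtain ⟨i, rfl⟩ := he y
      exact ⟨Finsupp.single i 1, by simp⟩
    have hker : LinearMap.ker (Finsupp.linearCombination T e)
        ≤ LinearMap.ker (Finsupp.linearCombination T m) := fun c hc => by
      rw [LinearMap.mem_ker] at hc ⊢
      rw [hrel, ← hcoe, hc, Submodule.coe_zero]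
    refine ⟨(Submodule.liftQ _ _ hker).comp
      ((Finsupp.linearCombination T e).quotKerEquivOfSurjective hsur).symm.toLinearMap,
      fun i => ?_⟩
    have : ((Finsupp.linearCombination T e).quotKerEquivOfSurjective hsur).symm (e i)
        = Submodule.Quotient.mk (Finsupp.single i 1) := by
      rw [LinearEquiv.symm_apply_eq]
      simp [LinearMap.quotKerEquivOfSurjective]
    simp [this]
  have hθG (y : N) : θ y ∈ G := by
    obtain ⟨i, rfl⟩ := he y
    exact hθ i ▸ hmG i
  have hθid (y : N) (hy : (y : F) ∈ G) : θ y = y := by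
    obtain ⟨i, rfl⟩ := he y
    exact (hθ i).trans (hmg i hy)
  refine ⟨LinearMap.range (N.subtype - θ), fun h => hx ?_, ?_, isPureSubmodule_range hsolv θ hθG
    hθid⟩
  · have : (N.subtype - θ) ⟨x, hxN⟩ = 0 := by
      rw [LinearMap.range_eq_bot.1 h, LinearMap.zero_apply]
    rw [LinearMap.sub_apply, sub_eq_zero] at this
    have h' := hθG ⟨x, hxN⟩
    rwa [← this] at h'
  · rintro _ ⟨y, rfl⟩
    obtain ⟨i, rfl⟩ := he y
    rw [LinearMap.mem_ker, LinearMap.sub_apply, map_sub, hθ, hφ, sub_eq_zero]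
    rfl

end Pure

/-! ### Classes closed under local membership -/

section LocalClosure

variable {T : Type u} [Ring T] {𝓕 : Set (ModuleCat.{w} T)}

theorem mem_of_linearEquiv (hloc : ∀ M : ModuleCat.{w} T, LocallyIn 𝓕 M → M ∈ 𝓕) {X Y : Type w}
    [AddCommGroup X] [Module T X] [AddCommGroup Y] [Module T Y] (e : X ≃ₗ[T] Y)
    (hX : ModuleCat.of T X ∈ 𝓕) : ModuleCat.of T Y ∈ 𝓕 := by
  refine hloc _ fun s E _ _ hE => ⟨_, hX, e.toLinearMap, fun y => e.symm y,
    fun x _ => e.apply_symm_apply x, fun r hr => ?_⟩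
  have := congrArg e.symm (hE r hr)
  rw [map_zero, ← LinearEquiv.coe_coe, Finsupp.apply_linearCombination] at this
  exact this

/-- A direct limit of members of `𝓕` lies locally in `𝓕`. -/
theorem locallyIn_of_directed {ι : Type*} [Preorder ι] [IsDirectedOrder ι] [Nonempty ι]
    {Y : ι → Type w} [∀ i, AddCommGroup (Y i)] [∀ i, Module T (Y i)]
    (hY : ∀ i, ModuleCat.of T (Y i) ∈ 𝓕) {M : Type w} [AddCommGroup M] [Module T M]
    (g : ∀ i, Y i →ₗ[T] M) (f : ∀ i j, i ≤ j → Y i →ₗ[T] Y j)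
    (hgf : ∀ i j h y, g j (f i j h y) = g i y)
    (hff : ∀ i j k hij hjk y, f j k hjk (f i j hij y) = f i k (hij.trans hjk) y)
    (hsurj : ∀ x, ∃ i y, g i y = x) (hinj : ∀ i y, g i y = 0 → ∃ j h, f i j h y = 0) :
    LocallyIn 𝓕 M := by
  classical
  intro s E hs hE hrel
  choose i y hy using hsurj
  let S : Set M := s ∪ ⋃ e ∈ E, (e.support : Set M)
  have hS : S.Finite := hs.union (hE.biUnion fun e _ => e.support.finite_toSet)
  obtain ⟨a, ha⟩ := (hS.image i).bddAbove
  have ha' (x) (hx : x ∈ S) : i x ≤ a := ha ⟨x, hx, rfl⟩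
  let σ : M → Y a := fun x => if h : x ∈ S then f _ _ (ha' x h) (y x) else 0
  have hσ (x) (hx : x ∈ S) : g a (σ x) = x := by
    simp only [σ, dif_pos hx, hgf, hy]
  have hker (e) (he : e ∈ E) : g a (Finsupp.linearCombination T σ e) = 0 := by
    rw [Finsupp.apply_linearCombination, ← hrel e he]
    refine Finsupp.sum_congr fun x hx => ?_
    have : g a (σ x) = x := hσ x (Or.inr (Set.mem_biUnion he hx))
    simp [this]
  have hj (e) : ∃ j, a ≤ j ∧ (e ∈ E → ∃ h, f a j h (Finsupp.linearCombination T σ e) = 0) := by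
    by_cases he : e ∈ E
    · obtain ⟨j, h, h'⟩ := hinj a _ (hker e he)
      exact ⟨j, h, fun _ => ⟨h, h'⟩⟩
    · exact ⟨a, le_rfl, fun h => absurd h he⟩
  choose j haj hj using hj
  obtain ⟨b, hb⟩ := ((hE.image j).insert a).bddAbove
  have hab : a ≤ b := hb (Set.mem_insert _ _)
  refine ⟨_, hY b, g b, fun x => f a b hab (σ x), fun x hx => ?_, fun e he => ?_⟩
  · rw [hgf]
    exact hσ x (Or.inl hx)
  · have hjb : j e ≤ b := hb (Set.mem_insert_of_mem _ ⟨e, he, rfl⟩)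
    obtain ⟨h, h'⟩ := hj e he
    have := congrArg (f _ _ hjb) h'
    rw [hff, map_zero, Finsupp.apply_linearCombination] at this
    exact this

/-- The quotient by the union of a chain of submodules is the direct limit of the quotients. -/
theorem quotient_sSup_mem (hloc : ∀ M : ModuleCat.{w} T, LocallyIn 𝓕 M → M ∈ 𝓕)
    {F : Type w} [AddCommGroup F] [Module T F] {c : Set (Submodule T F)} (hc : IsChain (· ≤ ·) c)
    (hne : c.Nonempty) (hmem : ∀ L ∈ c, ModuleCat.of T (F ⧸ L) ∈ 𝓕) :
    ModuleCat.of T (F ⧸ sSup c) ∈ 𝓕 := by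
  have : Nonempty c := hne.to_subtype
  have : IsDirectedOrder c := directedOn_iff_isDirectedOrder.1 hc.directedOn
  refine hloc _ (locallyIn_of_directed (ι := c) (Y := fun L => F ⧸ L.1) (fun L => hmem _ L.2)
    (fun L => Submodule.factor (le_sSup L.2)) (fun L L' h => Submodule.factor h) ?_ ?_ ?_ ?_)
  · rintro L L' h ⟨y⟩
    rfl
  · rintro L L' L'' h h' ⟨y⟩
    rfl
  · rintro ⟨x⟩
    obtain ⟨L, hL⟩ := hne
    exact ⟨⟨L, hL⟩, Submodule.Quotient.mk x, rfl⟩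
  · rintro L ⟨y⟩ hy
    have hy' : y ∈ sSup c := (Submodule.Quotient.mk_eq_zero _).1 hy
    obtain ⟨L', hL', hy'⟩ := (Submodule.mem_sSup_of_directed hne hc.directedOn).1 hy'
    obtain ⟨L'', h, h'⟩ := directed_of (· ≤ ·) L ⟨L', hL'⟩
    exact ⟨L'', h, (Submodule.Quotient.mk_eq_zero _).2 (h' hy')⟩

end LocalClosure

section SmallQuotient

open Cardinal

variable {T : Type u} [Ring T] {𝓕 : Set (ModuleCat.{max u v} T)}

/-- Every linear map from a member of `𝓕` to `M` factors through a quotient of bounded size that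
lies in `𝓕`: a maximal submodule of the kernel with quotient in `𝓕` leaves a quotient without
nonzero pure submodules in the kernel. -/
theorem exists_small_quotient
    (hloc : ∀ M : ModuleCat.{max u v} T, LocallyIn 𝓕 M → M ∈ 𝓕) {F M : Type max u v}
    [AddCommGroup F] [Module T F] [AddCommGroup M] [Module T M] (hF : ModuleCat.of T F ∈ 𝓕)
    (φ : F →ₗ[T] M) {μ : Cardinal.{max u v}} (h0 : ℵ₀ ≤ μ) (hT : lift.{max u v} #T ≤ μ)
    (hM : #M ≤ μ) :
    ∃ L : Submodule T F, L ≤ LinearMap.ker φ ∧ ModuleCat.of T (F ⧸ L) ∈ 𝓕 ∧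
      #(F ⧸ L) ≤ 2 ^ (2 ^ μ : Cardinal.{max u v}) := by
  obtain ⟨L, -, hL⟩ := zorn_le_nonempty₀
    {L : Submodule T F | L ≤ LinearMap.ker φ ∧ ModuleCat.of T (F ⧸ L) ∈ 𝓕}
    (fun c hcs hc y hy => ⟨sSup c, ⟨sSup_le fun L hL => (hcs hL).1,
      quotient_sSup_mem hloc hc ⟨y, hy⟩ fun L hL => (hcs hL).2⟩,
      fun L hL => le_sSup hL⟩) ⊥
    ⟨bot_le, mem_of_linearEquiv hloc (Submodule.quotEquivOfEqBot ⊥ rfl).symm hF⟩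
  refine ⟨L, hL.prop.1, hL.prop.2, ?_⟩
  by_contra! hcard
  obtain ⟨P, hP, hPker, hpure⟩ :=
    exists_pureSubmodule_le_ker.{u, v} (L.liftQ φ hL.prop.1) h0 hT hM hcard
  have hLP : L ≤ P.comap L.mkQ := fun x hx => by
    rw [Submodule.mem_comap, L.mkQ_apply, (Submodule.Quotient.mk_eq_zero L).2 hx]
    exact P.zero_mem
  have hmem : ModuleCat.of T (F ⧸ P.comap L.mkQ) ∈ 𝓕 := by
    have e := Submodule.quotientQuotientEquivQuotient L (P.comap L.mkQ) hLP
    rw [Submodule.map_comap_eq_of_surjective L.mkQ_surjective] at e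
    exact mem_of_linearEquiv hloc e (hloc _ (hpure.locallyIn hL.prop.2))
  have hle := hL.le_of_ge (y := P.comap L.mkQ) ⟨fun x hx => hPker hx, hmem⟩ hLP
  refine hP ((Submodule.eq_bot_iff P).2 fun x hx => ?_)
  obtain ⟨x, rfl⟩ := L.mkQ_surjective x
  exact (Submodule.Quotient.mk_eq_zero L).2 (hle hx)

end SmallQuotient

/-! ### Elements of a preorder that admit no strict growth -/

section Stabilization

open Cardinal

/-- A form of Zorn's lemma for a preorder in which only chains with at most `κ` elements need to be
bounded. The relation `s p q` says that something strictly grows from `p` to `q`. In each chain at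
most `κ` members `f ω` witness all growth, in the sense that nothing grows any more above an upper
bound of these witnesses. Then some element admits no strict growth above it. -/
theorem exists_stable {α : Type w} [Preorder α] {κ : Cardinal.{w}} {Q : α → Prop}
    {s : α → α → Prop} (irrefl : ∀ p, ¬ s p p)
    (mono : ∀ p q r, Q p → Q q → Q r → p ≤ q → q ≤ r → s p q → s p r)
    (bdd : ∀ c : Set α, IsChain (· ≤ ·) c → c.Nonempty → (∀ p ∈ c, Q p) → #c ≤ κ →
      ∃ u, Q u ∧ ∀ p ∈ c, p ≤ u)
    (wit : ∀ c : Set α, IsChain (· ≤ ·) c → c.Nonempty → (∀ p ∈ c, Q p) →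
      ∃ (Ω : Type w) (f : Ω → α), #Ω ≤ κ ∧ (∀ ω, f ω ∈ c) ∧
        ∀ p ∈ c, (∀ ω, f ω ≤ p) → ∀ q ∈ c, p ≤ q → ¬ s p q)
    (p : α) (hp : Q p) : ∃ m, p ≤ m ∧ Q m ∧ ∀ q, m ≤ q → Q q → ¬ s m q := by
  let r : {m // p ≤ m ∧ Q m} → {m // p ≤ m ∧ Q m} → Prop :=
    fun a b => a = b ∨ (a.1 ≤ b.1 ∧ s a.1 b.1)
  have r_le {a b} (h : r a b) : a.1 ≤ b.1 := by
    rcases h with rfl | h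
    exacts [le_rfl, h.1]
  obtain ⟨m, hm⟩ : ∃ m, ∀ a, r m a → r a m := by
    refine exists_maximal_of_chains_bounded (fun c hc => ?_) ?_
    · rcases c.eq_empty_or_nonempty with rfl | hne
      · exact ⟨⟨p, le_rfl, hp⟩, by simp⟩
      let c' : Set α := Subtype.val '' c
      have hc' : IsChain (· ≤ ·) c' := by
        rintro _ ⟨a, ha, rfl⟩ _ ⟨b, hb, rfl⟩ hab
        exact (hc ha hb (fun h => hab (congrArg _ h))).imp r_le r_le
      have hQ : ∀ a ∈ c', Q a := by
        rintro _ ⟨a, _, rfl⟩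
        exact a.2.2
      have htot : ∀ a ∈ c, ∀ b ∈ c, r a b ∨ r b a := fun a ha b hb => by
        by_cases hab : a = b
        · exact Or.inl (Or.inl hab)
        · exact hc ha hb hab
      obtain ⟨Ω, f, hΩ, hf, hwit⟩ := wit c' hc' (hne.image _) hQ
      by_cases h : ∃ a ∈ c, ∀ ω, f ω ≤ a.1
      · obtain ⟨a, ha, hfa⟩ := h
        refine ⟨a, fun b hb => ?_⟩
        rcases htot b hb a ha with h | h
        · exact h
        · rcases h with rfl | h
          · exact Or.inl rfl
          · exact absurd h.2 (hwit a.1 ⟨a, ha, rfl⟩ hfa b.1 ⟨b, hb, rfl⟩ h.1)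
      · push Not at h
        have hfc : Set.range f ⊆ c' := Set.range_subset_iff.2 hf
        obtain ⟨a₀, ha₀⟩ := hne
        obtain ⟨ω₀, -⟩ := h a₀ ha₀
        obtain ⟨x, hQx, hx⟩ := bdd (Set.range f) (hc'.mono hfc) ⟨_, ω₀, rfl⟩
          (fun a ha => hQ a (hfc ha)) (mk_range_le.trans hΩ)
        have hpx : p ≤ x := by
          obtain ⟨b, -, hb⟩ := hf ω₀
          exact (b.2.1.trans hb.le).trans (hx _ ⟨ω₀, rfl⟩)
        refine ⟨⟨x, hpx, hQx⟩, fun a ha => Or.inr ?_⟩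
        obtain ⟨ω, hω⟩ := h a ha
        obtain ⟨b, hb, hbω⟩ := hf ω
        have hbx : b.1 ≤ x := hbω.le.trans (hx _ ⟨ω, rfl⟩)
        rw [← hbω] at hω
        rcases htot a ha b hb with h | h
        · rcases h with rfl | h
          · exact absurd le_rfl hω
          · exact ⟨h.1.trans hbx, mono _ _ _ a.2.2 b.2.2 hQx h.1 hbx h.2⟩
        · exact absurd (r_le h) hω
    · rintro a b c (rfl | h) h'
      · exact h'
      · rcases h' with rfl | h'
        · exact Or.inr h
        · exact Or.inr ⟨h.1.trans h'.1, mono _ _ _ a.2.2 b.2.2 c.2.2 h.1 h'.1 h.2⟩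
  refine ⟨m.1, m.2.1, m.2.2, fun q hmq hQq hs => ?_⟩
  rcases hm ⟨q, m.2.1.trans hmq, hQq⟩ (Or.inr ⟨hmq, hs⟩) with h | h
  · have : q = m.1 := congrArg Subtype.val h
    subst this
    exact irrefl _ hs
  · exact irrefl _ (mono _ _ _ hQq m.2.2 hQq h.1 hmq h.2)

end Stabilization

/-! ### Stages: members of the class over `M` as subquotients of an ambient module -/

section Stages

open Cardinal

variable {T : Type u} [Ring T] {B M : Type w} [AddCommGroup B] [Module T B] [AddCommGroup M]
  [Module T M]

/-- A stage is a subquotient `A ⧸ L` of an ambient module `B` over `M` that lies in the class `𝓕`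
and on which the map to `M` is still defined. -/
structure Stage (𝓕 : Set (ModuleCat.{w} T)) (Φ : B →ₗ[T] M) where
  /-- the submodule of which a quotient is taken -/
  A : Submodule T B
  /-- the submodule of relations -/
  L : Submodule T B
  le : L ≤ A
  le_ker : L ≤ LinearMap.ker Φ
  mem : ModuleCat.of T (A ⧸ L.submoduleOf A) ∈ 𝓕

/-- The ambient module `Φ : B → M` is universal up to `κ` if every module of size at most `κ` over
`M` is a retract of `B` over `M`, by a retraction that vanishes on a given submodule of size at most
`κ`. -/
def IsUniversalUpTo (κ : Cardinal.{w}) (Φ : B →ₗ[T] M) : Prop :=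
  ∀ A : Submodule T B, #A ≤ κ → ∀ Z : ModuleCat.{w} T, #Z ≤ κ → ∀ ψ : Z →ₗ[T] M,
    ∃ (ι : Z →ₗ[T] B) (π : B →ₗ[T] Z), (∀ z, π (ι z) = z) ∧ (∀ z, Φ (ι z) = ψ z) ∧
      ∀ x ∈ A, π x = 0

namespace Stage

variable {𝓕 : Set (ModuleCat.{w} T)} {Φ : B →ₗ[T] M}

/-- Stages are ordered by inclusion of both submodules, so that an inequality of stages induces a
linear map of the subquotients over `M`, and these maps are automatically coherent. -/
instance : Preorder (Stage 𝓕 Φ) where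
  le p q := p.A ≤ q.A ∧ p.L ≤ q.L
  le_refl _ := ⟨le_rfl, le_rfl⟩
  le_trans _ _ _ h h' := ⟨h.1.trans h'.1, h.2.trans h'.2⟩

/-- The subquotient described by a stage. -/
abbrev Quot (p : Stage 𝓕 Φ) : Type w := p.A ⧸ p.L.submoduleOf p.A

/-- The quotient map of a stage. -/
abbrev proj (p : Stage 𝓕 Φ) : p.A →ₗ[T] p.Quot := (p.L.submoduleOf p.A).mkQ

theorem proj_surjective (p : Stage 𝓕 Φ) : Function.Surjective p.proj := Submodule.mkQ_surjective _

theorem proj_eq_zero (p : Stage 𝓕 Φ) (x : p.A) : p.proj x = 0 ↔ (x : B) ∈ p.L :=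
  Submodule.Quotient.mk_eq_zero _

/-- The structure map to `M` of the subquotient of a stage. -/
def toBase (p : Stage 𝓕 Φ) : p.Quot →ₗ[T] M :=
  (p.L.submoduleOf p.A).liftQ (Φ ∘ₗ p.A.subtype) fun _ hx => p.le_ker hx

/-- The transition map between the subquotients of two comparable stages. -/
def transition (p q : Stage 𝓕 Φ) (h : p ≤ q) : p.Quot →ₗ[T] q.Quot :=
  Submodule.mapQ _ _ (Submodule.inclusion h.1) fun _ hx => h.2 hx

theorem transition_proj (p q : Stage 𝓕 Φ) (h : p ≤ q) (x : p.A) :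
    p.transition q h (p.proj x) = q.proj (Submodule.inclusion h.1 x) := rfl

theorem toBase_transition (p q : Stage 𝓕 Φ) (h : p ≤ q) (y : p.Quot) :
    q.toBase (p.transition q h y) = p.toBase y := by
  obtain ⟨x, rfl⟩ := p.proj_surjective y
  rfl

/-- Every chain of stages has a union. -/
theorem exists_union (hloc : ∀ M : ModuleCat.{w} T, LocallyIn 𝓕 M → M ∈ 𝓕)
    {c : Set (Stage 𝓕 Φ)} (hc : IsChain (· ≤ ·) c) (hne : c.Nonempty) :
    ∃ U : Stage 𝓕 Φ, (∀ p ∈ c, p ≤ U) ∧ (∀ x ∈ U.A, ∃ p ∈ c, x ∈ p.A) ∧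
      ∀ x ∈ U.L, ∃ p ∈ c, x ∈ p.L := by
  have : Nonempty c := hne.to_subtype
  have : IsDirectedOrder c := directedOn_iff_isDirectedOrder.1 hc.directedOn
  obtain ⟨A, hA⟩ : ∃ A : Submodule T B, ∀ x, x ∈ A ↔ ∃ p : c, x ∈ p.1.A :=
    ⟨⨆ p : c, p.1.A, fun x => Submodule.mem_iSup_of_directed _ fun a b => by
      obtain ⟨d, h, h'⟩ := directed_of (· ≤ ·) a b
      exact ⟨d, h.1, h'.1⟩⟩
  obtain ⟨L, hL⟩ : ∃ L : Submodule T B, ∀ x, x ∈ L ↔ ∃ p : c, x ∈ p.1.L :=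
    ⟨⨆ p : c, p.1.L, fun x => Submodule.mem_iSup_of_directed _ fun a b => by
      obtain ⟨d, h, h'⟩ := directed_of (· ≤ ·) a b
      exact ⟨d, h.2, h'.2⟩⟩
  have hleA (p : c) : p.1.A ≤ A := fun x hx => (hA x).2 ⟨p, hx⟩
  have hleL (p : c) : p.1.L ≤ L := fun x hx => (hL x).2 ⟨p, hx⟩
  have hmem : ModuleCat.of T (A ⧸ L.submoduleOf A) ∈ 𝓕 := by
    refine hloc _ (locallyIn_of_directed (ι := c) (Y := fun p => p.1.Quot) (fun p => p.1.mem)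
      (fun p => Submodule.mapQ _ _ (Submodule.inclusion (hleA p)) fun _ hx => hleL p hx)
      (fun p q h => p.1.transition q.1 h) ?_ ?_ ?_ ?_)
    · rintro p q h ⟨y⟩
      rfl
    · rintro p q r h h' ⟨y⟩
      rfl
    · rintro ⟨x, hx⟩
      obtain ⟨p, hp⟩ := (hA x).1 hx
      exact ⟨p, p.1.proj ⟨x, hp⟩, rfl⟩
    · intro p y hy
      obtain ⟨x, rfl⟩ := p.1.proj_surjective y
      have hx : Submodule.inclusion (hleA p) x ∈ L.submoduleOf A :=
        (Submodule.Quotient.mk_eq_zero _).1 hy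
      obtain ⟨q, hq⟩ := (hL x).1 hx
      obtain ⟨r, h, h'⟩ := directed_of (· ≤ ·) p q
      refine ⟨r, h, ?_⟩
      rw [transition_proj, proj_eq_zero]
      exact h'.2 hq
  refine ⟨⟨A, L, fun x hx => ?_, fun x hx => ?_, hmem⟩, fun p hp => ⟨hleA ⟨p, hp⟩, hleL ⟨p, hp⟩⟩,
    fun x hx => ?_, fun x hx => ?_⟩
  · obtain ⟨p, hp⟩ := (hL x).1 hx
    exact (hA x).2 ⟨p, p.1.le hp⟩
  · obtain ⟨p, hp⟩ := (hL x).1 hx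
    exact p.1.le_ker hp
  · obtain ⟨p, hp⟩ := (hA x).1 hx
    exact ⟨p, p.2, hp⟩
  · obtain ⟨p, hp⟩ := (hL x).1 hx
    exact ⟨p, p.2, hp⟩

/-- A stage is rigid if every linear map over `M` from its subquotient to a member of `𝓕` is
injective. -/
def Rigid (p : Stage 𝓕 Φ) : Prop :=
  ∀ Z : ModuleCat.{w} T, Z ∈ 𝓕 → ∀ (h : p.Quot →ₗ[T] Z) (ψ : Z →ₗ[T] M),
    ψ ∘ₗ h = p.toBase → Function.Injective h

theorem Rigid.mem_of_le {p q : Stage 𝓕 Φ} (hp : p.Rigid) (h : p ≤ q) {x : B} (hx : x ∈ p.A)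
    (hx' : x ∈ q.L) : x ∈ p.L := by
  have hinj := hp (.of T q.Quot) q.mem (p.transition q h) q.toBase
    (LinearMap.ext (toBase_transition p q h))
  refine (p.proj_eq_zero ⟨x, hx⟩).1 (hinj ?_)
  rw [map_zero, transition_proj, proj_eq_zero]
  exact hx'

/-- The union of a chain of rigid stages is rigid. -/
theorem rigid_of_union {c : Set (Stage 𝓕 Φ)} (hc : ∀ p ∈ c, p.Rigid) {U : Stage 𝓕 Φ}
    (hU : ∀ p ∈ c, p ≤ U) (hUA : ∀ x ∈ U.A, ∃ p ∈ c, x ∈ p.A) : U.Rigid := by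
  intro Z hZ h ψ hψ
  refine (injective_iff_map_eq_zero _).2 fun y hy => ?_
  obtain ⟨x, rfl⟩ := U.proj_surjective y
  obtain ⟨p, hp, hx⟩ := hUA x x.2
  have hinj := hc p hp Z hZ (h ∘ₗ p.transition U (hU p hp)) ψ (by
    rw [← LinearMap.comp_assoc, hψ]
    exact LinearMap.ext (toBase_transition p U (hU p hp)))
  have : p.proj ⟨x, hx⟩ = 0 := hinj (by rw [map_zero]; exact hy)
  rw [proj_eq_zero] at this ⊢
  exact (hU p hp).2 this

theorem card_union_le {κ : Cardinal.{w}} (h0 : ℵ₀ ≤ κ) {c : Set (Stage 𝓕 Φ)} (hcκ : #c ≤ κ)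
    (hc : ∀ p ∈ c, #p.A ≤ κ) {U : Stage 𝓕 Φ} (hUA : ∀ x ∈ U.A, ∃ p ∈ c, x ∈ p.A) :
    #U.A ≤ κ := by
  have h : (U.A : Set B) ⊆ ⋃ p : c, (p.1.A : Set B) := fun x hx => by
    obtain ⟨p, hp, hx⟩ := hUA x hx
    exact Set.mem_iUnion.2 ⟨⟨p, hp⟩, hx⟩
  refine (mk_le_mk_of_subset h).trans (mk_iUnion_le_sum_mk.trans ?_)
  refine (sum_le_sum _ (fun _ => κ) fun p : c => hc p.1 p.2).trans ?_
  rw [sum_const']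
  exact (mul_le_mul' hcκ le_rfl).trans (mul_eq_self h0).le

/-- In a universal ambient module, each linear map over `M` from the subquotient of a small stage to
a small member of `𝓕` is the transition map to some larger stage. -/
theorem exists_extension (hloc : ∀ M : ModuleCat.{w} T, LocallyIn 𝓕 M → M ∈ 𝓕)
    {κ : Cardinal.{w}} (h0 : ℵ₀ ≤ κ) (hΦ : IsUniversalUpTo κ Φ) (p : Stage 𝓕 Φ) (hp : #p.A ≤ κ)
    (Z : ModuleCat.{w} T) (hZ : Z ∈ 𝓕) (hZκ : #Z ≤ κ) (h : p.Quot →ₗ[T] Z) (ψ : Z →ₗ[T] M)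
    (hψ : ψ ∘ₗ h = p.toBase) :
    ∃ (q : Stage 𝓕 Φ) (hpq : p ≤ q) (e : q.Quot ≃ₗ[T] Z), #q.A ≤ κ ∧
      (∀ y, ψ (e y) = q.toBase y) ∧ ∀ y, e (p.transition q hpq y) = h y := by
  obtain ⟨ι, π, hπι, hΦι, hπ⟩ := hΦ p.A hp Z hZκ ψ
  -- `A' = A ⊕ ι Z`, described by its two projections
  let A' : Submodule T B := p.A.comap (LinearMap.id - ι ∘ₗ π)
  let k : A' →ₗ[T] p.A := (LinearMap.id - ι ∘ₗ π).restrict fun _ hx => hx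
  let f : A' →ₗ[T] Z := h ∘ₗ p.proj ∘ₗ k + π ∘ₗ A'.subtype
  have hk (x : A') : ((k x : p.A) : B) = x - ι (π x) := rfl
  have hf (x : A') : f x = h (p.proj (k x)) + π x := rfl
  have hψf (x : A') : ψ (f x) = Φ x := by
    have : ψ (h (p.proj (k x))) = Φ (k x) := DFunLike.congr_fun hψ (p.proj (k x))
    rw [hf, map_add, this, hk, map_sub, hΦι, sub_add_cancel]
  have hle : p.A ≤ A' := fun x hx => by
    simpa [A', hπ x hx] using hx
  have hfA (x : B) (hx : x ∈ p.A) : f ⟨x, hle hx⟩ = h (p.proj ⟨x, hx⟩) := by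
    have : k ⟨x, hle hx⟩ = ⟨x, hx⟩ := Subtype.ext (by simp [hk, hπ x hx])
    rw [hf, this, hπ x hx, add_zero]
  have hsurj : Function.Surjective f := fun z => by
    have hz : ι z ∈ A' := by simp [A', hπι]
    refine ⟨⟨ι z, hz⟩, ?_⟩
    have : k ⟨ι z, hz⟩ = 0 := Subtype.ext (by simp [hk, hπι])
    rw [hf, this, map_zero, map_zero, zero_add, hπι]
  let L' : Submodule T B := (LinearMap.ker f).map A'.subtype
  have hL' : L'.submoduleOf A' = LinearMap.ker f :=
    Submodule.comap_map_eq_of_injective A'.injective_subtype _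
  let e : (A' ⧸ L'.submoduleOf A') ≃ₗ[T] Z :=
    (Submodule.quotEquivOfEq _ _ hL').trans (f.quotKerEquivOfSurjective hsurj)
  have he (x : A') : e (Submodule.Quotient.mk x) = f x := rfl
  let q : Stage 𝓕 Φ :=
    { A := A'
      L := L'
      le := Submodule.map_subtype_le _ _
      le_ker := by
        rintro _ ⟨x, hx, rfl⟩
        have hx : f x = 0 := hx
        rw [LinearMap.mem_ker, Submodule.subtype_apply, ← hψf, hx, map_zero]
      mem := mem_of_linearEquiv hloc e.symm hZ }
  refine ⟨q, ⟨hle, fun x hx => ⟨⟨x, hle (p.le hx)⟩, ?_, rfl⟩⟩, e, ?_, fun y => ?_, fun y => ?_⟩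
  · change f _ = 0
    rw [hfA x (p.le hx), (p.proj_eq_zero _).2 hx, map_zero]
  · have hinj : Function.Injective fun x : A' => (k x, π x) := fun x y hxy => by
      obtain ⟨h₁, h₂⟩ := Prod.ext_iff.1 hxy
      have h₁ := congrArg Subtype.val h₁
      simp only [hk] at h₁ h₂
      rw [h₂] at h₁
      exact Subtype.ext (sub_left_inj.1 h₁)
    refine (mk_le_of_injective hinj).trans ?_
    rw [mk_prod, lift_id, lift_id]
    exact (mul_le_mul' hp hZκ).trans (mul_eq_self h0).le
  · obtain ⟨x, rfl⟩ := q.proj_surjective y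
    exact hψf x
  · obtain ⟨x, rfl⟩ := p.proj_surjective y
    exact hfA x x.2

end Stage

end Stages

/-! ### Rigid and maximal stages -/

section Stages

open Cardinal

variable {T : Type u} [Ring T] {B M : Type w} [AddCommGroup B] [Module T B] [AddCommGroup M]
  [Module T M]

/-- Every linear map from a member of `𝓕` to `M` factors through a quotient of size at most `κ` that
lies in `𝓕`. -/
def HasSmallQuotients (𝓕 : Set (ModuleCat.{w} T)) (M : Type w) [AddCommGroup M] [Module T M]
    (κ : Cardinal.{w}) : Prop :=
  ∀ F : ModuleCat.{w} T, F ∈ 𝓕 → ∀ φ : F →ₗ[T] M, ∃ L : Submodule T F, L ≤ LinearMap.ker φ ∧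
    ModuleCat.of T (F ⧸ L) ∈ 𝓕 ∧ #(F ⧸ L) ≤ κ

namespace Stage

variable {𝓕 : Set (ModuleCat.{w} T)} {Φ : B →ₗ[T] M} {κ : Cardinal.{w}}

theorem L_le_of_le {p q : Stage 𝓕 Φ} (h : p ≤ q) : p.L ≤ q.L := h.2

/-- Above each small stage `p` there is a small stage `q` such that no element of `p` that is
nonzero in `q` vanishes in a later stage. -/
theorem exists_stable_kernel (hloc : ∀ M : ModuleCat.{w} T, LocallyIn 𝓕 M → M ∈ 𝓕) (h0 : ℵ₀ ≤ κ)
    (p : Stage 𝓕 Φ) (hp : #p.A ≤ κ) :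
    ∃ q, p ≤ q ∧ #q.A ≤ κ ∧ ∀ r, q ≤ r → #r.A ≤ κ → ∀ x ∈ p.A, x ∈ r.L → x ∈ q.L := by
  obtain ⟨q, hpq, hq, h⟩ := exists_stable (α := Stage 𝓕 Φ) (κ := κ) (Q := fun q => #q.A ≤ κ)
    (s := fun q r => ∃ x ∈ p.A, x ∈ r.L ∧ x ∉ q.L) (by simp)
    (fun a b c _ _ _ _ hbc ⟨x, hx, hx', hx''⟩ => ⟨x, hx, L_le_of_le hbc hx', hx''⟩)
    (fun c hc hne hQ hcκ => by
      obtain ⟨U, hU, hUA, -⟩ := exists_union hloc hc hne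
      exact ⟨U, card_union_le h0 hcκ hQ hUA, hU⟩)
    (fun c hc hne hQ => by
      choose f hf hf' using fun x : {x : p.A // ∃ q ∈ c, (x : B) ∈ q.L} => x.2
      exact ⟨_, f, (mk_subtype_le _).trans hp, hf, fun a _ hle b hb _ ⟨x, hx, hxb, hxa⟩ =>
        hxa ((hle ⟨⟨x, hx⟩, b, hb, hxb⟩).2 (hf' _))⟩) p hp
  refine ⟨q, hpq, hq, fun r hqr hr x hx hxr => ?_⟩
  by_contra hxq
  exact h r hqr hr ⟨x, hx, hxr, hxq⟩

/-- Every small stage lies below a small rigid stage. -/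
theorem exists_rigid (hloc : ∀ M : ModuleCat.{w} T, LocallyIn 𝓕 M → M ∈ 𝓕) (h0 : ℵ₀ ≤ κ)
    (hsmall : HasSmallQuotients 𝓕 M κ) (hΦ : IsUniversalUpTo κ Φ) (p : Stage 𝓕 Φ)
    (hp : #p.A ≤ κ) : ∃ q, p ≤ q ∧ #q.A ≤ κ ∧ q.Rigid := by
  choose next hle hcard hker using fun q : {q : Stage 𝓕 Φ // #q.A ≤ κ} =>
    exists_stable_kernel hloc h0 q.1 q.2
  let seq : ℕ → {q : Stage 𝓕 Φ // #q.A ≤ κ} :=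
    fun n => Nat.rec ⟨p, hp⟩ (fun _ q => ⟨next q, hcard q⟩) n
  have hmono : Monotone fun n => (seq n).1 := monotone_nat_of_le_succ fun n => hle (seq n)
  obtain ⟨U, hU, hUA, -⟩ := exists_union hloc (c := Set.range fun n => (seq n).1)
    hmono.isChain_range ⟨_, 0, rfl⟩
  have hUn (n) : (seq n).1 ≤ U := hU _ ⟨n, rfl⟩
  have hUκ : #U.A ≤ κ := by
    refine card_union_le h0 ?_ ?_ hUA
    · exact (Set.countable_range _).le_aleph0.trans h0
    · rintro _ ⟨n, rfl⟩
      exact (seq n).2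
  refine ⟨U, hUn 0, hUκ, fun Z hZ h ψ hψ => ?_⟩
  obtain ⟨K, hK, hKmem, hKκ⟩ := hsmall Z hZ ψ
  obtain ⟨r, hUr, e, hr, -, he⟩ := exists_extension hloc h0 hΦ U hUκ _ hKmem hKκ
    (K.mkQ ∘ₗ h) (K.liftQ ψ hK) (by rw [← hψ]; rfl)
  refine (injective_iff_map_eq_zero _).2 fun y hy => ?_
  have hy' : U.transition r hUr y = 0 := e.injective (by
    rw [he, LinearMap.comp_apply, hy, map_zero, map_zero])
  obtain ⟨x, rfl⟩ := U.proj_surjective y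
  rw [transition_proj, proj_eq_zero] at hy'
  obtain ⟨_, ⟨n, rfl⟩, hx⟩ := hUA x x.2
  rw [proj_eq_zero]
  exact (hUn (n + 1)).2 (hker (seq n) r ((hUn (n + 1)).trans hUr) hr x hx hy')

/-- There is a small rigid stage that maps onto all later small rigid stages. -/
theorem exists_maximal_rigid (hloc : ∀ M : ModuleCat.{w} T, LocallyIn 𝓕 M → M ∈ 𝓕) (h0 : ℵ₀ ≤ κ)
    (hsmall : HasSmallQuotients 𝓕 M κ) (p : Stage 𝓕 Φ)
    (hp : #p.A ≤ κ) (hrig : p.Rigid) :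
    ∃ q : Stage 𝓕 Φ, #q.A ≤ κ ∧ q.Rigid ∧
      ∀ r, q ≤ r → #r.A ≤ κ → r.Rigid → r.A ≤ q.A ⊔ r.L := by
  obtain ⟨q, -, ⟨hq, hqr⟩, h⟩ := exists_stable (α := Stage 𝓕 Φ) (κ := κ)
    (Q := fun q => #q.A ≤ κ ∧ q.Rigid) (s := fun q r => ¬ r.A ≤ q.A ⊔ r.L)
    (fun p h => h le_sup_left) (fun a b c _ hb _ hab hbc h h' => h fun x hx => by
      obtain ⟨y, hy, z, hz, rfl⟩ := Submodule.mem_sup.1 (h' (hbc.1 hx))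
      refine Submodule.add_mem_sup hy (hb.2.mem_of_le hbc ?_ hz)
      simpa using b.A.sub_mem hx (hab.1 hy))
    (fun c hc hne hQ hcκ => by
      obtain ⟨U, hU, hUA, -⟩ := exists_union hloc hc hne
      exact ⟨U, ⟨card_union_le h0 hcκ (fun p hp => (hQ p hp).1) hUA,
        rigid_of_union (fun p hp => (hQ p hp).2) hU hUA⟩, hU⟩)
    (fun c hc hne hQ => by
      -- the union of the chain is rigid, hence embeds into a small module, whatever the size of `c`
      obtain ⟨U, hU, hUA, hUL⟩ := exists_union hloc hc hne
      have hUr : U.Rigid := rigid_of_union (fun p hp => (hQ p hp).2) hU hUA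
      obtain ⟨K, hK, hKmem, hKκ⟩ := hsmall _ U.mem U.toBase
      have hinj : Function.Injective K.mkQ :=
        hUr _ hKmem K.mkQ (K.liftQ U.toBase hK) (K.liftQ_mkQ _ hK)
      choose x hx using U.proj_surjective
      choose f hf hf' using fun y : U.Quot => hUA (x y) (x y).2
      refine ⟨U.Quot, f, (mk_le_of_injective hinj).trans hKκ, hf, fun a ha hle b hb hab h => ?_⟩
      refine h fun z hz => ?_
      let z' : U.A := ⟨z, (hU b hb).1 hz⟩
      have hxa : (x (U.proj z') : B) ∈ a.A := (hle _).1 (hf' _)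
      have hL : z - x (U.proj z') ∈ U.L := by
        have : U.proj (z' - x (U.proj z')) = 0 := by rw [map_sub, hx, sub_self]
        exact (U.proj_eq_zero _).1 this
      obtain ⟨d, hd, hLd⟩ := hUL _ hL
      have hLb : z - x (U.proj z') ∈ b.L := by
        rcases hc.total hd hb with hdb | hbd
        · exact hdb.2 hLd
        · exact (hQ b hb).2.mem_of_le hbd (b.A.sub_mem hz (hab.1 hxa)) hLd
      simpa using Submodule.add_mem_sup hxa hLb) p ⟨hp, hrig⟩
  exact ⟨q, hq, hqr, fun r hqr hr hr' => not_not.1 (h r hqr ⟨hr, hr'⟩)⟩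

/-- If nothing grows above the small rigid stage `m`, then its subquotient is a cover of `M`. -/
theorem isCover_of_maximal (hloc : ∀ M : ModuleCat.{w} T, LocallyIn 𝓕 M → M ∈ 𝓕)
    (hprod : ∀ X Y : ModuleCat.{w} T, X ∈ 𝓕 → Y ∈ 𝓕 → ModuleCat.of T (X × Y) ∈ 𝓕) (h0 : ℵ₀ ≤ κ)
    (hsmall : HasSmallQuotients 𝓕 M κ) (hΦ : IsUniversalUpTo κ Φ) (m : Stage 𝓕 Φ)
    (hm : #m.A ≤ κ) (hrig : m.Rigid)
    (hmax : ∀ r, m ≤ r → #r.A ≤ κ → r.Rigid → r.A ≤ m.A ⊔ r.L) :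
    IsCover 𝓕 (X := .of T m.Quot) (M := .of T M) m.toBase := by
  have hbij (r : Stage 𝓕 Φ) (hmr : m ≤ r) (hr : #r.A ≤ κ) (hr' : r.Rigid) :
      Function.Bijective (m.transition r hmr) := by
    refine ⟨hrig (.of T r.Quot) r.mem _ r.toBase (LinearMap.ext (toBase_transition m r hmr)),
      fun y => ?_⟩
    obtain ⟨x, rfl⟩ := r.proj_surjective y
    obtain ⟨a, ha, l, hl, hal⟩ := Submodule.mem_sup.1 (hmax r hmr hr hr' x.2)
    refine ⟨m.proj ⟨a, ha⟩, ?_⟩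
    rw [transition_proj, ← sub_eq_zero, ← map_sub, proj_eq_zero]
    have : a - x = -l := by rw [← hal]; abel
    simpa [this] using hl
  refine ⟨⟨m.mem, fun X hX k => ?_⟩, fun f hf => ?_⟩
  · -- map `m.Quot × X` to a small module, and then to a rigid stage, which is isomorphic to `m`
    let φ : m.Quot × X →ₗ[T] M := m.toBase.coprod k
    obtain ⟨K, hK, hKmem, hKκ⟩ := hsmall (.of T (m.Quot × X)) (hprod _ _ m.mem hX) φ
    obtain ⟨r, hmr, e, hr, hψe, he⟩ := exists_extension hloc h0 hΦ m hm (.of T (_ ⧸ K)) hKmem hKκ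
      (K.mkQ ∘ₗ LinearMap.inl T m.Quot X) (K.liftQ φ hK) (LinearMap.ext fun y => by
        change φ (y, 0) = _
        simp [φ])
    obtain ⟨q, hrq, hq, hq'⟩ := exists_rigid hloc h0 hsmall hΦ r hr
    let ε := LinearEquiv.ofBijective _ (hbij q (hmr.trans hrq) hq hq')
    have hε (y : q.Quot) : m.toBase (ε.symm y) = q.toBase y := by
      obtain ⟨y, rfl⟩ := ε.surjective y
      rw [LinearEquiv.symm_apply_apply]
      exact (toBase_transition m q (hmr.trans hrq) y).symm
    refine ⟨ε.symm.toLinearMap ∘ₗ r.transition q hrq ∘ₗ e.symm.toLinearMap ∘ₗ K.mkQ ∘ₗ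
      LinearMap.inr T m.Quot X, LinearMap.ext fun x => ?_⟩
    change m.toBase (ε.symm (r.transition q hrq (e.symm (K.mkQ (0, x))))) = k x
    rw [hε, toBase_transition, ← hψe, LinearEquiv.apply_symm_apply]
    change φ (0, x) = _
    simp [φ]
  · have hfinj : Function.Injective f := hrig _ m.mem f m.toBase hf
    refine ⟨hfinj, ?_⟩
    -- `f` is the transition map to a stage that is isomorphic to `m`, hence rigid
    obtain ⟨r, hmr, e, hr, hψe, he⟩ := exists_extension hloc h0 hΦ m hm (.of T m.Quot) m.mem
      (mk_quotient_le.trans hm) f m.toBase hf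
    have hr' : r.Rigid := fun Z hZ h ψ hψ => by
      have := hrig Z hZ (h ∘ₗ e.symm.toLinearMap) ψ (LinearMap.ext fun y => by
        have h₁ := DFunLike.congr_fun hψ (e.symm y)
        have h₂ := hψe (e.symm y)
        rw [LinearEquiv.apply_symm_apply] at h₂
        exact h₁.trans h₂.symm)
      intro a b hab
      refine e.injective (this ?_)
      simpa using hab
    intro y
    obtain ⟨z, hz⟩ := (hbij r hmr hr hr').2 (e.symm y)
    exact ⟨z, by rw [← he, hz, LinearEquiv.apply_symm_apply]⟩

end Stage

end Stages

/-! ### Existence of covers -/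

section Covers

open Cardinal

variable {T : Type u} [Ring T]

/-- The modules over `M` of size at most that of `K`, up to isomorphism: quotients of the free
module on `K` together with a linear map to `M`. -/
abbrev SmallOver (T : Type u) [Ring T] (M K : Type max u v) [AddCommGroup M] [Module T M] :
    Type max u v :=
  Σ L : Submodule T (K →₀ T), ((K →₀ T) ⧸ L) →ₗ[T] M

/-- The underlying module of a member of `SmallOver T M K`. -/
def SmallOver.Carrier {M K : Type max u v} [AddCommGroup M] [Module T M]
    (z : SmallOver.{u, v} T M K) : Type max u v :=
  (K →₀ T) ⧸ z.1

noncomputable instance {M K : Type max u v} [AddCommGroup M] [Module T M]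
    (z : SmallOver.{u, v} T M K) : AddCommGroup z.Carrier :=
  inferInstanceAs (AddCommGroup ((K →₀ T) ⧸ z.1))

noncomputable instance {M K : Type max u v} [AddCommGroup M] [Module T M]
    (z : SmallOver.{u, v} T M K) : Module T z.Carrier :=
  inferInstanceAs (Module T ((K →₀ T) ⧸ z.1))

/-- The linear map to `M` of a member of `SmallOver T M K`. -/
def SmallOver.toBase {M K : Type max u v} [AddCommGroup M] [Module T M]
    (z : SmallOver.{u, v} T M K) : z.Carrier →ₗ[T] M :=
  z.2

/-- The direct sum of copies, indexed by the subsets of `K`, of all modules in `SmallOver T M K`. -/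
abbrev UniversalModule (T : Type u) [Ring T] (M K : Type max u v) [AddCommGroup M] [Module T M] :
    Type max u v :=
  Π₀ z : Set K × SmallOver.{u, v} T M K, z.2.Carrier

/-- Every module has a universal ambient module: a direct sum of sufficiently many copies of all
small modules over it. -/
theorem exists_isUniversalUpTo (M : Type max u v) [AddCommGroup M] [Module T M]
    {κ : Cardinal.{max u v}} (h0 : ℵ₀ ≤ κ) :
    ∃ B : ModuleCat.{max u v} T, ∃ Φ : B →ₗ[T] M, IsUniversalUpTo κ Φ := by
  classical
  obtain ⟨K, rfl⟩ : ∃ K : Type max u v, #K = κ := ⟨_, mk_out κ⟩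
  refine ⟨.of T (UniversalModule.{u, v} T M K),
    DFinsupp.lsum ℕ fun z : Set K × SmallOver.{u, v} T M K => z.2.toBase, fun A hA Z hZ ψ => ?_⟩
  obtain ⟨i, hi⟩ : ∃ i : Set K, ∀ a ∈ A, ∀ j : SmallOver.{u, v} T M K,
      (a : UniversalModule.{u, v} T M K) (i, j) = 0 := by
    by_contra! h
    have hsub : (Set.univ : Set (Set K)) ⊆
        ⋃ a : A, ((a : UniversalModule.{u, v} T M K).support.image Prod.fst : Finset (Set K)) :=
        fun i _ => by
      obtain ⟨a, ha, j, hj⟩ := h i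
      refine Set.mem_iUnion.2 ⟨⟨a, ha⟩, ?_⟩
      rw [Finset.mem_coe, Finset.mem_image]
      exact ⟨(i, j), DFinsupp.mem_support_iff.2 hj, rfl⟩
    refine (cantor #K).not_ge ?_
    rw [← mk_set, ← mk_univ]
    refine (mk_le_mk_of_subset hsub).trans (mk_iUnion_le_sum_mk.trans ?_)
    refine (sum_le_sum _ (fun _ => ℵ₀) fun a => (Finset.countable_toSet _).le_aleph0).trans ?_
    rw [sum_const']
    exact (mul_le_mul' hA h0).trans (mul_eq_self h0).le
  obtain ⟨e, he⟩ : ∃ e : K → Z, Function.Surjective e := by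
    obtain ⟨j⟩ := (le_def _ _).1 hZ
    exact ⟨_, Function.invFun_surjective j.injective⟩
  let p : (K →₀ T) →ₗ[T] Z := Finsupp.linearCombination T e
  have hp : Function.Surjective p := fun y => by
    obtain ⟨k, rfl⟩ := he y
    exact ⟨Finsupp.single k 1, by simp [p]⟩
  let j : SmallOver.{u, v} T M K :=
    ⟨LinearMap.ker p, ψ ∘ₗ (p.quotKerEquivOfSurjective hp).toLinearMap⟩
  let E : j.Carrier ≃ₗ[T] Z := p.quotKerEquivOfSurjective hp
  let z : Set K × SmallOver.{u, v} T M K := (i, j)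
  refine ⟨(DFinsupp.lsingle z : _ →ₗ[T] UniversalModule.{u, v} T M K) ∘ₗ E.symm.toLinearMap,
    E.toLinearMap ∘ₗ (DFinsupp.lapply z : UniversalModule.{u, v} T M K →ₗ[T] _), fun y => ?_,
    fun y => ?_, fun a ha => ?_⟩
  · change E ((DFinsupp.single z (E.symm y) : UniversalModule.{u, v} T M K) z) = y
    rw [DFinsupp.single_eq_same, LinearEquiv.apply_symm_apply]
  · change DFinsupp.lsum ℕ (fun z : Set K × SmallOver.{u, v} T M K => z.2.toBase)
      (DFinsupp.single z (E.symm y)) = _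
    rw [DFinsupp.lsum_single]
    change ψ (E (E.symm y)) = _
    rw [LinearEquiv.apply_symm_apply]
  · change E (a z) = 0
    rw [show a z = 0 from hi a ha j, map_zero]

/-- A class of modules that is closed under local membership and under binary products, and that
contains the zero module, is covering. -/
theorem exists_isCover {𝓕 : Set (ModuleCat.{max u v} T)}
    (hloc : ∀ M : ModuleCat.{max u v} T, LocallyIn 𝓕 M → M ∈ 𝓕)
    (hzero : ModuleCat.of T PUnit.{max u v + 1} ∈ 𝓕)
    (hprod : ∀ X Y : ModuleCat.{max u v} T, X ∈ 𝓕 → Y ∈ 𝓕 → ModuleCat.of T (X × Y) ∈ 𝓕)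
    (M : ModuleCat.{max u v} T) :
    ∃ (X : ModuleCat.{max u v} T) (φ : X →ₗ[T] M), IsCover 𝓕 φ := by
  let μ : Cardinal.{max u v} := ℵ₀ + lift.{max u v} #T + #M
  have h0 : ℵ₀ ≤ μ := (self_le_add_right _ _).trans (self_le_add_right _ _)
  have hT : lift.{max u v} #T ≤ μ := (self_le_add_left _ _).trans (self_le_add_right _ _)
  have hM : #M ≤ μ := self_le_add_left _ _
  let κ : Cardinal.{max u v} := 2 ^ (2 ^ μ : Cardinal.{max u v})
  have h0κ : ℵ₀ ≤ κ := h0.trans ((cantor _).le.trans (cantor _).le)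
  have hsmall : HasSmallQuotients 𝓕 M κ := fun F hF φ =>
    exists_small_quotient.{u, v} hloc hF φ h0 hT hM
  obtain ⟨B, Φ, hΦ⟩ := exists_isUniversalUpTo.{u, v} (T := T) M h0κ
  let p₀ : Stage 𝓕 Φ :=
    { A := ⊥
      L := ⊥
      le := le_rfl
      le_ker := bot_le
      mem := by
        have : Subsingleton ((⊥ : Submodule T B) ⧸ (⊥ : Submodule T B).submoduleOf ⊥) :=
          (Submodule.mkQ_surjective _).subsingleton
        exact mem_of_linearEquiv hloc (0 : PUnit.{max u v + 1} ≃ₗ[T] _) hzero }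
  have hp₀ : #p₀.A ≤ κ := (lt_aleph0_of_finite (⊥ : Submodule T B)).le.trans h0κ
  obtain ⟨p, -, hp, hrig⟩ := p₀.exists_rigid hloc h0κ hsmall hΦ hp₀
  obtain ⟨m, hm, hmrig, hmax⟩ := p.exists_maximal_rigid hloc h0κ hsmall hp hrig
  exact ⟨.of T m.Quot, m.toBase, m.isCover_of_maximal hloc hprod h0κ hsmall hΦ hm hmrig hmax⟩

end Covers

end RelPure

/-- For every class `S` of left modules over a ring `R`, every right `R`-module (a module over
`Rᵐᵒᵖ`) has an `S`-pure flat cover. -/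
theorem corollary2p3 {R : Type u} [Ring R] (S : Set (ModuleCat.{max u v} R))
    (M : ModuleCat.{max u v} Rᵐᵒᵖ) :
    ∃ (X : ModuleCat.{max u v} Rᵐᵒᵖ) (φ : X →ₗ[Rᵐᵒᵖ] M),
      RelPure.IsCover (RelPure.pureFlat S) φ :=
  RelPure.exists_isCover.{u, v} (fun _ => RelPure.mem_pureFlat_of_locallyIn S)
    (RelPure.punit_mem_pureFlat S) (fun _ _ => RelPure.prod_mem_pureFlat S) M
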